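/- Let $\mathbb{H}^1$ be the first Heisenberg group, that is, $\mathbb{R}^3$ with the group law $(x,y,t)(x',y',t')=(x+x',\,y+y',\,t+t'-2(xy'-yx'))$, with left-invariant horizontal vector fields $X=\partial_x+2y\,\partial_t$ and $Y=\partial_y-2x\,\partial_t$. The Carnot--Carathéodory (CC) distance between $p,q\in\mathbb{H}^1$ is the infimum of $\int_0^1|u(s)|\,ds$ over all absolutely continuous curves $\gamma\colon[0,1]\to\mathbb{R}^3$ with $\gamma(0)=p$, $\gamma(1)=q$, and $\gamma'=u_1X(\gamma)+u_2Y(\gamma)$ almost everywhere for some $u=(u_1,u_2)\in L^1([0,1];\mathbb{R}^2)$. Let $(M,d)$ be a metric space, $E\subset M$ and $\lambda\in(0,1)$. The set $E$ is $\lambda$-porous at $a\in E$ if there are points $x_n\in M$ with $x_n\neq a$, $x_n\to a$, and $B(x_n,\lambda d(x_n,a))\cap E=\varnothing$ for every $n$, where $B$ denotes open balls. It is porous at $a$ if it is $\lambda$-porous at $a$ for some $\lambda\in(0,1)$, and it is porous if there is a single $\lambda\in(0,1)$ such that it is $\lambda$-porous at each of its points. Let $C\subset[0,1]$ be the middle third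 Cantor set and, for integers $n\geq 1$ and $0\leq k\leq 2^n-1$, let \[A_{n,k}=(2^{-n}+k2^{-2n})+2^{-2n}C.\] Let $\Lambda=\{(x,y,t)\in\mathbb{H}^1\colon |t|\leq |(x,y)|\}$, where $|(x,y)|=\sqrt{x^2+y^2}$, and \[P_e=\Lambda\cap\Big(\{0\}\cup\bigcup_{n=1}^{\infty}\bigcup_{k=0}^{2^n-1}\{(x,y,t)\in\mathbb{H}^1\colon |(x,y)|\in A_{n,k}\}\Big).\] Then $P_e$ is porous with respect to the Euclidean distance on $\mathbb{R}^3$, but $P_e$ (which contains $0$) is not porous at $0$ with respect to the CC distance. -/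

import Mathlib

open Set Filter Topology MeasureTheory
open scoped ENNReal

noncomputable section

/-! ### Porosity with respect to a distance `d` on `M` -/

/-- `E` is `lam`-porous at `a` with respect to the distance `d`: there are points `x n ≠ a`
converging to `a` such that the open balls `B (x n, lam * d (x n, a))` do not meet `E`. Without
`x n ≠ a` the constant sequence `a` (with empty balls of radius `0`) would always be admissible. -/
def IsPorousAtWith {M : Type*} (d : M → M → ℝ≥0∞) (lam : ℝ) (E : Set M) (a : M) : Prop :=
  ∃ x : ℕ → M, (∀ n, x n ≠ a) ∧ Tendsto (fun n => d (x n) a) atTop (𝓝 0) ∧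
    ∀ n, {y | d y (x n) < ENNReal.ofReal lam * d (x n) a} ∩ E = ∅

/-- `E` is porous at `a`. -/
def IsPorousAt {M : Type*} (d : M → M → ℝ≥0∞) (E : Set M) (a : M) : Prop :=
  ∃ lam ∈ Ioo (0 : ℝ) 1, IsPorousAtWith d lam E a

/-- `E` is porous: it is `lam`-porous at each of its points, with `lam` independent of the point. -/
def IsPorousSet {M : Type*} (d : M → M → ℝ≥0∞) (E : Set M) : Prop :=
  ∃ lam ∈ Ioo (0 : ℝ) 1, ∀ a ∈ E, IsPorousAtWith d lam E a

/-! ### The first Heisenberg group -/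

/-- The underlying space `ℝ³` of the first Heisenberg group, with points `(x, y, t)`. Its Mathlib
distance is the Euclidean one. -/
abbrev Heisenberg : Type := EuclideanSpace ℝ (Fin 3)

namespace Heisenberg

/-- The group law
`(x, y, t) (x', y', t') = (x + x', y + y', t + t' - 2 (x y' - y x'))`. -/
def mul (p q : Heisenberg) : Heisenberg :=
  !₂[p 0 + q 0, p 1 + q 1, p 2 + q 2 - 2 * (p 0 * q 1 - p 1 * q 0)]

/-- The group structure; the identity is `0` and the inverse of `p` is `-p`. -/
instance group : Group Heisenberg where
  mul := mul
  one := 0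
  inv p := -p
  mul_assoc p q r := by
    change mul (mul p q) r = mul p (mul q r)
    ext i
    fin_cases i <;> simp [mul] <;> ring
  one_mul p := by
    change mul 0 p = p
    ext i
    fin_cases i <;> simp [mul]
  mul_one p := by
    change mul p 0 = p
    ext i
    fin_cases i <;> simp [mul]
  inv_mul_cancel p := by
    change mul (-p) p = 0
    ext i
    fin_cases i <;> simp [mul]
    ring

/-- The Euclidean norm `|(x, y)|` of the horizontal part of `(x, y, t)`. -/
def horizontalNorm (p : Heisenberg) : ℝ := √(p 0 ^ 2 + p 1 ^ 2)

/-- The left-invariant horizontal vector field `X = ∂_x + 2 y ∂_t`. -/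
def fieldX (p : Heisenberg) : Heisenberg := !₂[1, 0, 2 * p 1]

/-- The left-invariant horizontal vector field `Y = ∂_y - 2 x ∂_t`. -/
def fieldY (p : Heisenberg) : Heisenberg := !₂[0, 1, -2 * p 0]

/-- `X` is the left-invariant vector field which equals `∂_x` at the identity. -/
theorem hasDerivAt_mul_fieldX (p : Heisenberg) :
    HasDerivAt (fun s : ℝ => p * (!₂[s, 0, 0] : Heisenberg)) (fieldX p) 0 := by
  have h : (fun s : ℝ => p * (!₂[s, 0, 0] : Heisenberg)) = fun s => p + s • fieldX p := by
    funext s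
    change mul p _ = _
    ext i
    fin_cases i <;> simp [mul, fieldX]
    ring
  rw [h]
  simpa using ((hasDerivAt_id (0 : ℝ)).smul_const (fieldX p)).const_add p

/-- `Y` is the left-invariant vector field which equals `∂_y` at the identity. -/
theorem hasDerivAt_mul_fieldY (p : Heisenberg) :
    HasDerivAt (fun s : ℝ => p * (!₂[0, s, 0] : Heisenberg)) (fieldY p) 0 := by
  have h : (fun s : ℝ => p * (!₂[0, s, 0] : Heisenberg)) = fun s => p + s • fieldY p := by
    funext s
    change mul p _ = _
    ext i
    fin_cases i <;> simp [mul, fieldY]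
    ring
  rw [h]
  simpa using ((hasDerivAt_id (0 : ℝ)).smul_const (fieldY p)).const_add p

/-- `γ : [0, 1] → ℍ¹` is a horizontal curve with controls `u = (u₁, u₂)`: it is absolutely
continuous, `u` is integrable on `[0, 1]`, and `γ' = u₁ X(γ) + u₂ Y(γ)` almost everywhere. -/
structure IsHorizontal (γ : ℝ → Heisenberg) (u : ℝ → EuclideanSpace ℝ (Fin 2)) : Prop where
  absolutelyContinuous : AbsolutelyContinuousOnInterval γ 0 1
  integrable : IntegrableOn u (Icc 0 1)
  hasDerivAt : ∀ᵐ s ∂(volume.restrict (Icc (0 : ℝ) 1)),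
    HasDerivAt γ (u s 0 • fieldX (γ s) + u s 1 • fieldY (γ s)) s

/-- The Carnot-Carathéodory distance: the infimum of the lengths `∫₀¹ |u|` of the horizontal curves
joining `p` to `q` (the infimum of the empty set is `∞`). -/
def ccDist (p q : Heisenberg) : ℝ≥0∞ :=
  ⨅ (γ : ℝ → Heisenberg) (u : ℝ → EuclideanSpace ℝ (Fin 2))
    (_ : IsHorizontal γ u ∧ γ 0 = p ∧ γ 1 = q), ENNReal.ofReal (∫ s in (0 : ℝ)..1, ‖u s‖)

/-- The cone `Λ = {|t| ≤ |(x, y)|}`. -/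
def cone : Set Heisenberg := {p | |p 2| ≤ horizontalNorm p}

/-- The set `A_{n,k} = (2^{-n} + k 2^{-2n}) + 2^{-2n} C`, with `C` the middle third Cantor set. -/
def scaledCantor (n k : ℕ) : Set ℝ :=
  (fun s : ℝ => ((1 / 2) ^ n + k * (1 / 2) ^ (2 * n)) + (1 / 2) ^ (2 * n) * s) '' cantorSet

/-- The set `P_e`: the points of the cone `Λ` that are `0` or satisfy `|(x, y)| ∈ A_{n,k}` for some
`n ≥ 1` and `0 ≤ k ≤ 2 ^ n - 1`. -/
def setPe : Set Heisenberg :=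
  cone ∩ ({0} ∪ ⋃ n ∈ Ici (1 : ℕ), ⋃ k ∈ Iio (2 ^ n : ℕ),
    {p | horizontalNorm p ∈ scaledCantor n k})

end Heisenberg

end

/-! Euclidean porosity: at `0`, the points `(0, 0, τ)` lie at distance `τ` from `0` and at
comparable distance from the cone. At any other point, move radially at fixed height into a Cantor
gap (`exists_gap_cantorSet`). As `horizontalNorm` is 1-Lipschitz and the blocks are similar copies
of `C`, the constant does not depend on `n`, `k`.

CC distance: if `p` is near `0` and `m` is its homogeneous norm, then `r = |(x, y)| ≤ 2 m` and `|t|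
≤ 4 m ^ 2`. A radial move at fixed height costs only its length. Reaching the cone costs `O(m ^ 2)`,
and so does reaching some `A_{n,k}` from there (`exists_mem_scaledCantor_near`). Hence `P_e` comes
within `8 m ^ 2 = o(m)` of `p`, while `m ≤ ccDist p 0` (`le_ccDist_zero`): no hole is proportional
to the distance. -/

theorem one_mem_cantorSet : (1 : ℝ) ∈ cantorSet := by
  refine mem_iInter.2 fun n => ?_
  induction n with
  | zero => simp
  | succ n ih => exact Or.inr ⟨1, ih, by norm_num⟩

/-- Near each point of the Cantor set there are, at all scales `3⁻ᵐ`, gaps of comparable length. -/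
theorem exists_gap_cantorSet (m : ℕ) {s : ℝ} (hs : s ∈ cantorSet) :
    ∃ c, |c - s| ≤ (1 / 3) ^ m ∧
      Ioo (c - (1 / 3) ^ m / 6) (c + (1 / 3) ^ m / 6) ⊆ Ioo 0 1 \ cantorSet := by
  have key : ∀ y ∈ cantorSet, (∃ z ∈ cantorSet, z / 3 = y) ∨ ∃ z ∈ cantorSet, (2 + z) / 3 = y := by
    intro y hy
    rw [cantorSet_eq_union_halves] at hy
    exact hy
  induction m generalizing s with
  | zero =>
    have h01 := cantorSet_subset_unitInterval hs
    -- The removed middle third has centre `1 / 2` and radius `1 / 6`.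
    refine ⟨1 / 2, ?_, fun y hy => ⟨?_, fun hyC => ?_⟩⟩
    · rw [abs_le]
      constructor <;> norm_num <;> linarith [h01.1, h01.2]
    · constructor <;> norm_num at hy <;> linarith [hy.1, hy.2]
    · norm_num at hy
      rcases key y hyC with ⟨z, hz, rfl⟩ | ⟨z, hz, rfl⟩ <;>
        linarith [hy.1, hy.2, (cantorSet_subset_unitInterval hz).1,
          (cantorSet_subset_unitInterval hz).2]
  | succ m ih =>
    have hpow : ((1 : ℝ) / 3) ^ (m + 1) = (1 / 3) ^ m / 3 := by ring
    rw [hpow]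
    rcases key s hs with ⟨s', hs', rfl⟩ | ⟨s', hs', rfl⟩ <;> obtain ⟨c, hc, hgap⟩ := ih hs'
    · refine ⟨c / 3, ?_, fun y hy => ?_⟩
      · rw [abs_le] at hc ⊢
        constructor <;> linarith [hc.1, hc.2]
      · obtain ⟨h3, h3C⟩ := hgap (show 3 * y ∈ _ from ⟨by linarith [hy.1], by linarith [hy.2]⟩)
        refine ⟨⟨by linarith [h3.1], by linarith [h3.2]⟩, fun hyC => ?_⟩
        -- Keeping gaps inside `(0, 1)` gives `y < 1 / 3`, which rules out the other half.
        rcases key y hyC with ⟨z, hz, rfl⟩ | ⟨z, hz, rfl⟩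
        · exact h3C (by convert hz using 1; ring)
        · linarith [h3.2, (cantorSet_subset_unitInterval hz).1]
    · refine ⟨(2 + c) / 3, ?_, fun y hy => ?_⟩
      · rw [abs_le] at hc ⊢
        constructor <;> linarith [hc.1, hc.2]
      · obtain ⟨h3, h3C⟩ := hgap (show 3 * y - 2 ∈ _ from ⟨by linarith [hy.1], by linarith [hy.2]⟩)
        refine ⟨⟨by linarith [h3.1], by linarith [h3.2]⟩, fun hyC => ?_⟩
        rcases key y hyC with ⟨z, hz, rfl⟩ | ⟨z, hz, rfl⟩
        · linarith [h3.1, (cantorSet_subset_unitInterval hz).2]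
        · exact h3C (by convert hz using 1; ring)

/-! ### Position of the scaled Cantor sets -/

namespace Heisenberg

theorem half_pow_two_mul (n : ℕ) : ((1 : ℝ) / 2) ^ (2 * n) = ((1 / 2) ^ n) ^ 2 := by
  rw [mul_comm, pow_mul]

theorem two_pow_mul_half_pow (n : ℕ) : (2 : ℝ) ^ n * (1 / 2) ^ n = 1 := by
  rw [← mul_pow]; norm_num

/-- The sets `A_{n,k}` for the same `n` lie in the dyadic interval `[2⁻ⁿ, 2¹⁻ⁿ]`. -/
theorem scaledCantor_block_le {n k : ℕ} (hk : k < 2 ^ n) :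
    (k + 1 : ℝ) * (1 / 2) ^ (2 * n) ≤ (1 / 2) ^ n := by
  have h1 : (k + 1 : ℝ) ≤ 2 ^ n := by exact_mod_cast hk
  have h2 : (0 : ℝ) < (1 / 2) ^ n := by positivity
  rw [half_pow_two_mul]
  nlinarith [two_pow_mul_half_pow n, mul_le_mul_of_nonneg_right h1 (sq_nonneg (((1 : ℝ) / 2) ^ n))]

/-- The interiors of the convex hulls of the sets `A_{n,k}` are disjoint from the other sets. -/
theorem eq_of_mem_scaledCantor {n k n' k' : ℕ} (hk : k < 2 ^ n) (hk' : k' < 2 ^ n') {g : ℝ}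
    (hg : g ∈ Ioo (0 : ℝ) 1)
    (h : (1 / 2) ^ n + k * (1 / 2) ^ (2 * n) + (1 / 2) ^ (2 * n) * g ∈ scaledCantor n' k') :
    n = n' ∧ k = k' := by
  obtain ⟨s, hs, hsg⟩ := h
  have hs01 := cantorSet_subset_unitInterval hs
  have hb := scaledCantor_block_le hk
  have hb' := scaledCantor_block_le hk'
  have hQ : (0 : ℝ) < (1 / 2) ^ (2 * n) := by positivity
  have hQ' : (0 : ℝ) < (1 / 2) ^ (2 * n') := by positivity
  have hkQ : (0 : ℝ) ≤ k * (1 / 2) ^ (2 * n) := by positivity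
  have hkQ' : (0 : ℝ) ≤ k' * (1 / 2) ^ (2 * n') := by positivity
  have e1 : 0 < ((1 : ℝ) / 2) ^ (2 * n) * g := mul_pos hQ hg.1
  have e2 : ((1 : ℝ) / 2) ^ (2 * n) * g < (1 / 2) ^ (2 * n) := by nlinarith [hg.2]
  have e1' : 0 ≤ ((1 : ℝ) / 2) ^ (2 * n') * s := mul_nonneg hQ'.le hs01.1
  have e2' : ((1 : ℝ) / 2) ^ (2 * n') * s ≤ (1 / 2) ^ (2 * n') := by nlinarith [hs01.2]
  have hmono : ∀ a b : ℕ, a < b → 2 * ((1 : ℝ) / 2) ^ b ≤ (1 / 2) ^ a := by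
    intro a b hab
    have := pow_le_pow_of_le_one (by norm_num : (0 : ℝ) ≤ 1 / 2) (by norm_num) (Nat.succ_le_of_lt hab)
    rw [pow_succ] at this
    linarith
  have hn : n = n' := by
    rcases lt_trichotomy n n' with hlt | heq | hlt
    · have := hmono _ _ hlt
      nlinarith
    · exact heq
    · have := hmono _ _ hlt
      nlinarith
  subst hn
  refine ⟨rfl, ?_⟩
  rcases lt_trichotomy k k' with hlt | heq | hlt
  · have : (k + 1 : ℝ) ≤ k' := by exact_mod_cast hlt
    nlinarith
  · exact heq
  · have : (k' + 1 : ℝ) ≤ k := by exact_mod_cast hlt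
    nlinarith

/-- Each `ρ ∈ (0, 1]` is within `ρ²` of a larger element of some `A_{n,k}`. -/
theorem exists_mem_scaledCantor_near {ρ : ℝ} (h0 : 0 < ρ) (h1 : ρ ≤ 1) :
    ∃ n ≥ 1, ∃ k < 2 ^ n, ∃ r ∈ scaledCantor n k, ρ ≤ r ∧ r ≤ ρ + ρ ^ 2 := by
  obtain ⟨n, hn1, hn2⟩ := exists_nat_pow_near_of_lt_one h0 h1 (by norm_num : (0 : ℝ) < 1 / 2)
    (by norm_num)
  have hQ : (0 : ℝ) < (1 / 2) ^ (n + 1) := by positivity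
  have htwo := two_pow_mul_half_pow (n + 1)
  have hdouble : ((1 : ℝ) / 2) ^ n = 2 * (1 / 2) ^ (n + 1) := by ring
  set q : ℝ := (1 / 2) ^ (n + 1) with hq
  -- With `q < ρ ≤ 2 q`, the right ends of the blocks form a grid of step `q ^ 2 < ρ ^ 2`. Rounding
  -- up lands on the right end of block `m - 1`.
  set m := ⌈(ρ - q) / q ^ 2⌉₊ with hm
  have hpos : 0 < (ρ - q) / q ^ 2 := div_pos (by linarith) (by positivity)
  have hmpos : 0 < m := Nat.ceil_pos.2 hpos
  have hle : m ≤ 2 ^ (n + 1) := by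
    refine Nat.ceil_le.2 ?_
    rw [div_le_iff₀ (by positivity)]
    push_cast
    nlinarith
  have hm1 : (ρ - q) ≤ m * q ^ 2 := (div_le_iff₀ (by positivity)).1 (Nat.le_ceil _)
  have hm2 : m * q ^ 2 < (ρ - q) + q ^ 2 := by
    have := mul_lt_mul_of_pos_right (Nat.ceil_lt_add_one hpos.le) (by positivity : 0 < q ^ 2)
    rwa [add_mul, one_mul, div_mul_cancel₀ _ (by positivity)] at this
  refine ⟨n + 1, by omega, m - 1, by omega, q + m * q ^ 2, ⟨1, one_mem_cantorSet, ?_⟩, ?_, ?_⟩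
  · simp only [half_pow_two_mul, ← hq]
    rw [Nat.cast_sub hmpos]
    push_cast
    ring
  · linarith
  · nlinarith

end Heisenberg

/-- The increments of an absolutely continuous function are bounded by the integral of any bound
on its derivative. -/
theorem AbsolutelyContinuousOnInterval.abs_sub_le_integral {f w : ℝ → ℝ} {a b : ℝ} (hab : a ≤ b)
    (hf : AbsolutelyContinuousOnInterval f a b) (hw : IntegrableOn w (Icc a b))
    (h : ∀ᵐ s ∂volume.restrict (Icc a b), |deriv f s| ≤ w s) {s : ℝ} (hs : s ∈ Icc a b) :
    |f s - f b| ≤ ∫ x in a..b, w x := by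
  have hsub : Ioc s b ⊆ Icc a b := fun x hx => ⟨hs.1.trans hx.1.le, hx.2⟩
  have hfs := (hf.mono (c := s) (d := b) (by
    rw [uIcc_of_le hs.2, uIcc_of_le hab]; exact Icc_subset_Icc_left hs.1)).integral_deriv_eq_sub
  rw [abs_sub_comm, ← hfs, intervalIntegral.integral_of_le hs.2,
    intervalIntegral.integral_of_le hab, ← Real.norm_eq_abs]
  calc ‖∫ x in Ioc s b, deriv f x‖ ≤ ∫ x in Ioc s b, w x :=
        norm_integral_le_of_norm_le (hw.mono_set hsub) (ae_restrict_of_ae_restrict_of_subset hsub h)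
    _ ≤ ∫ x in Ioc a b, w x := by
        refine setIntegral_mono_set (hw.mono_set Ioc_subset_Icc_self) ?_
          (Ioc_subset_Ioc_left hs.1).eventuallyLE
        filter_upwards [ae_restrict_of_ae_restrict_of_subset Ioc_subset_Icc_self h] with x hx
        exact (abs_nonneg _).trans hx

/-! ### Carnot-Carathéodory estimates and non-porosity at `0` -/

namespace Heisenberg

theorem IsHorizontal.coord {γ : ℝ → Heisenberg} {u : ℝ → EuclideanSpace ℝ (Fin 2)}
    (h : IsHorizontal γ u) (i : Fin 3) :
    AbsolutelyContinuousOnInterval (fun s => γ s i) 0 1 := by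
  refine squeeze_zero (fun E => Finset.sum_nonneg fun _ _ => dist_nonneg) (fun E => ?_)
    h.absolutelyContinuous
  refine Finset.sum_le_sum fun j _ => ?_
  rw [dist_eq_norm, dist_eq_norm]
  exact PiLp.norm_apply_le (γ (E.2 j).1 - γ (E.2 j).2) i

theorem IsHorizontal.deriv_coord {γ : ℝ → Heisenberg} {u : ℝ → EuclideanSpace ℝ (Fin 2)}
    (h : IsHorizontal γ u) : ∀ᵐ s ∂(volume.restrict (Icc (0 : ℝ) 1)),
      deriv (fun s => γ s 0) s = u s 0 ∧ deriv (fun s => γ s 1) s = u s 1 ∧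
      deriv (fun s => γ s 2) s = 2 * (γ s 1 * u s 0 - γ s 0 * u s 1) := by
  filter_upwards [h.hasDerivAt] with s hs
  have hc := fun i => ((EuclideanSpace.proj (𝕜 := ℝ) i).hasFDerivAt.comp_hasDerivAt s hs).deriv
  refine ⟨(hc 0).trans ?_, (hc 1).trans ?_, (hc 2).trans ?_⟩ <;> simp [fieldX, fieldY]
  ring

/-- A horizontal curve from `p` to `0` of length `L` satisfies `|x|, |y| ≤ L` and `|t| ≤ 4 L²`. -/
theorem IsHorizontal.bounds {γ : ℝ → Heisenberg} {u : ℝ → EuclideanSpace ℝ (Fin 2)}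
    (h : IsHorizontal γ u) (h1 : γ 1 = 0) {s : ℝ} (hs : s ∈ Icc (0 : ℝ) 1) :
    |γ s 0| ≤ ∫ s in (0 : ℝ)..1, ‖u s‖ ∧ |γ s 1| ≤ ∫ s in (0 : ℝ)..1, ‖u s‖ ∧
      |γ s 2| ≤ 4 * (∫ s in (0 : ℝ)..1, ‖u s‖) ^ 2 := by
  set L := ∫ s in (0 : ℝ)..1, ‖u s‖ with hL
  have hu : ∀ s i, |u s i| ≤ ‖u s‖ := fun s i => PiLp.norm_apply_le (u s) i
  have hx : ∀ s ∈ Icc (0 : ℝ) 1, |γ s 0| ≤ L := by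
    intro s hs
    simpa [h1] using (h.coord 0).abs_sub_le_integral zero_le_one h.integrable.norm
      (by filter_upwards [h.deriv_coord] with s hs; rw [hs.1]; exact hu s 0) hs
  have hy : ∀ s ∈ Icc (0 : ℝ) 1, |γ s 1| ≤ L := by
    intro s hs
    simpa [h1] using (h.coord 1).abs_sub_le_integral zero_le_one h.integrable.norm
      (by filter_upwards [h.deriv_coord] with s hs; rw [hs.2.1]; exact hu s 1) hs
  refine ⟨hx s hs, hy s hs, ?_⟩
  have hL0 : 0 ≤ L := (abs_nonneg _).trans (hx s hs)
  -- Since `|x|, |y| ≤ L` along the whole curve, `|t'| = 2 |y u₁ - x u₂| ≤ 4 L |u|`.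
  have key := (h.coord 2).abs_sub_le_integral zero_le_one (h.integrable.norm.const_mul (4 * L))
    (by
      filter_upwards [h.deriv_coord, ae_restrict_mem measurableSet_Icc] with s hs hmem
      rw [hs.2.2, abs_mul, abs_two]
      have e1 : |γ s 1 * u s 0| ≤ L * ‖u s‖ := by
        rw [abs_mul]; exact mul_le_mul (hy s hmem) (hu s 0) (abs_nonneg _) hL0
      have e2 : |γ s 0 * u s 1| ≤ L * ‖u s‖ := by
        rw [abs_mul]; exact mul_le_mul (hx s hmem) (hu s 1) (abs_nonneg _) hL0
      linarith [abs_sub (γ s 1 * u s 0) (γ s 0 * u s 1)]) hs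
  rw [intervalIntegral.integral_const_mul, ← hL] at key
  simp only [h1, PiLp.zero_apply, sub_zero] at key
  linarith

theorem horizontalNorm_nonneg (p : Heisenberg) : 0 ≤ horizontalNorm p := Real.sqrt_nonneg _

/-- The Carnot-Carathéodory distance to `0` bounds a homogeneous norm. -/
theorem le_ccDist_zero (p : Heisenberg) :
    ENNReal.ofReal (max (horizontalNorm p / 2) (√|p 2| / 2)) ≤ ccDist p 0 := by
  refine le_iInf fun γ => le_iInf fun u => le_iInf fun ⟨h, h0, h1⟩ => ENNReal.ofReal_le_ofReal ?_
  obtain ⟨hx, hy, ht⟩ := h.bounds h1 (left_mem_Icc.2 zero_le_one)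
  rw [h0] at hx hy ht
  have hL0 := (abs_nonneg _).trans hx
  refine max_le ?_ ?_
  · have : horizontalNorm p ≤ 2 * ∫ s in (0 : ℝ)..1, ‖u s‖ := by
      refine Real.sqrt_le_iff.2 ⟨by linarith, ?_⟩
      nlinarith [sq_le_sq' (abs_le.1 hx).1 (abs_le.1 hx).2, sq_le_sq' (abs_le.1 hy).1 (abs_le.1 hy).2]
    linarith
  · have : √|p 2| ≤ 2 * ∫ s in (0 : ℝ)..1, ‖u s‖ :=
      Real.sqrt_le_iff.2 ⟨by linarith, by linarith⟩
    linarith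

/-- Radial segments at constant height are horizontal. -/
theorem ccDist_radial_le {a b c d t : ℝ} (hv : c ^ 2 + d ^ 2 = 1) :
    ccDist !₂[a * c, a * d, t] !₂[b * c, b * d, t] ≤ ENNReal.ofReal |b - a| := by
  set γ : ℝ → Heisenberg := fun s => !₂[a * c, a * d, t] + s • !₂[(b - a) * c, (b - a) * d, 0]
  have hlen : ‖(!₂[(b - a) * c, (b - a) * d] : EuclideanSpace ℝ (Fin 2))‖ = |b - a| := by
    rw [EuclideanSpace.norm_eq, ← Real.sqrt_sq_eq_abs]
    congr 1
    simp [mul_pow]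
    linear_combination (b - a) ^ 2 * hv
  have hγ : IsHorizontal γ fun _ => !₂[(b - a) * c, (b - a) * d] := by
    refine ⟨ContDiffOn.absolutelyContinuousOnInterval ?_, by simp, ae_of_all _ fun s => ?_⟩
    · exact (contDiff_const.add (contDiff_id.smul contDiff_const)).contDiffOn
    -- The control is parallel to the horizontal position, so the `∂_t` components cancel.
    · have hvel : (((b - a) * c) • fieldX (γ s) + ((b - a) * d) • fieldY (γ s) : Heisenberg) =
          (1 : ℝ) • !₂[(b - a) * c, (b - a) * d, 0] := by
        ext i
        fin_cases i <;> simp [fieldX, fieldY, γ]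
        ring
      have := ((hasDerivAt_id s).smul_const
        (!₂[(b - a) * c, (b - a) * d, 0] : Heisenberg)).const_add !₂[a * c, a * d, t]
      rw [← hvel] at this
      exact this
  have hle : ccDist (γ 0) (γ 1) ≤ ENNReal.ofReal (∫ _ in (0 : ℝ)..1,
      ‖(!₂[(b - a) * c, (b - a) * d] : EuclideanSpace ℝ (Fin 2))‖) :=
    iInf_le_of_le γ <| iInf_le_of_le _ <| iInf_le_of_le ⟨hγ, rfl, rfl⟩ le_rfl
  have h0 : γ 0 = !₂[a * c, a * d, t] := by simp [γ]
  have h1 : γ 1 = !₂[b * c, b * d, t] := by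
    ext i
    fin_cases i <;> simp [γ] <;> ring
  rwa [h0, h1, hlen, intervalIntegral.integral_const, sub_zero, one_smul] at hle

/-- Polar coordinates for the horizontal part. -/
theorem exists_polar (p : Heisenberg) : ∃ c d : ℝ, c ^ 2 + d ^ 2 = 1 ∧
    p = !₂[horizontalNorm p * c, horizontalNorm p * d, p 2] := by
  have hsq : horizontalNorm p ^ 2 = p 0 ^ 2 + p 1 ^ 2 := Real.sq_sqrt (by positivity)
  rcases (horizontalNorm_nonneg p).eq_or_lt with h | h
  · refine ⟨1, 0, by norm_num, ?_⟩
    rw [← h] at hsq ⊢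
    have h0 : p 0 = 0 := by nlinarith [sq_nonneg (p 0), sq_nonneg (p 1)]
    have h1 : p 1 = 0 := by nlinarith [sq_nonneg (p 0), sq_nonneg (p 1)]
    ext i
    fin_cases i <;> simp [h0, h1]
  · refine ⟨p 0 / horizontalNorm p, p 1 / horizontalNorm p, ?_, ?_⟩
    · field_simp
      linarith
    · ext i
      fin_cases i <;> simp <;> field_simp

theorem horizontalNorm_polar {r c d t : ℝ} (hr : 0 ≤ r) (hv : c ^ 2 + d ^ 2 = 1) :
    horizontalNorm !₂[r * c, r * d, t] = r := by
  have : (r * c) ^ 2 + (r * d) ^ 2 = r ^ 2 := by linear_combination r ^ 2 * hv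
  simp [horizontalNorm, this, Real.sqrt_sq hr]

theorem zero_mem_setPe : (0 : Heisenberg) ∈ setPe :=
  ⟨by simp [cone, horizontalNorm], Or.inl rfl⟩

theorem mem_setPe_of_mem_scaledCantor {p : Heisenberg} {n k : ℕ} (hn : 1 ≤ n) (hk : k < 2 ^ n)
    (hp : horizontalNorm p ∈ scaledCantor n k) (ht : |p 2| ≤ horizontalNorm p) : p ∈ setPe :=
  ⟨ht, Or.inr (mem_biUnion (mem_Ici.2 hn) (mem_biUnion (mem_Iio.2 hk) hp))⟩

theorem not_isPorousAt_ccDist : ¬ IsPorousAt ccDist setPe 0 := by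
  rintro ⟨lam, ⟨hlam0, hlam1⟩, x, hx, hlim, hball⟩
  -- The threshold `lam / 8` yields `8 m ^ 2 < lam * m`.
  obtain ⟨n, hn⟩ := (hlim.eventually_lt_const
    (ENNReal.ofReal_pos.2 (show 0 < lam / 8 by linarith))).exists
  set p := x n
  set r := horizontalNorm p with hr
  set m := max (r / 2) (√|p 2| / 2) with hm
  have hlow : ENNReal.ofReal m ≤ ccDist p 0 := le_ccDist_zero p
  have hmlam : m < lam / 8 := (ENNReal.ofReal_lt_ofReal_iff (by linarith)).1 (hlow.trans_lt hn)
  have hr0 : 0 ≤ r := horizontalNorm_nonneg p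
  have hrm : r ≤ 2 * m := by linarith [le_max_left (r / 2) (√|p 2| / 2)]
  have htm : |p 2| ≤ 4 * m ^ 2 := by
    have h1 : √|p 2| ≤ 2 * m := by linarith [le_max_right (r / 2) (√|p 2| / 2)]
    nlinarith [Real.sq_sqrt (abs_nonneg (p 2)), Real.sqrt_nonneg |p 2|]
  obtain ⟨c, d, hv, hp⟩ := exists_polar p
  rw [← hr] at hp
  have hρ0 : 0 < max r |p 2| := by
    by_contra! hle
    have h1 : r = 0 := le_antisymm ((le_max_left _ _).trans hle) hr0
    have h2 : p 2 = 0 := abs_nonpos_iff.1 ((le_max_right _ _).trans hle)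
    refine hx n ?_
    change p = 0
    rw [hp, h1, h2]
    ext i
    fin_cases i <;> simp
  have hm0 : 0 < m := by
    rcases lt_max_iff.1 hρ0 with h | h
    · linarith
    · nlinarith
  have hρ1 : max r |p 2| ≤ 1 := max_le (by linarith) (by nlinarith)
  -- Starting from `max r |p 2|` and moving outwards keeps the target in the cone.
  obtain ⟨N, hN, k, hk, r', hr', hr1, hr2⟩ := exists_mem_scaledCantor_near hρ0 hρ1
  have hrr' : r ≤ r' := (le_max_left _ _).trans hr1
  have hdist : |r - r'| ≤ 8 * m ^ 2 := by
    rw [abs_sub_comm, abs_of_nonneg (by linarith)]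
    rcases le_total r |p 2| with h | h
    · rw [max_eq_right h] at hr2 hρ1
      nlinarith [abs_nonneg (p 2)]
    · rw [max_eq_left h] at hr2
      nlinarith
  have hnorm := horizontalNorm_polar (t := p 2) (hr0.trans hrr') hv
  have hmem : (!₂[r' * c, r' * d, p 2] : Heisenberg) ∈ setPe :=
    mem_setPe_of_mem_scaledCantor hN hk (by rwa [hnorm])
      (by rw [hnorm]; exact (le_max_right _ _).trans hr1)
  refine (eq_empty_iff_forall_notMem.1 (hball n)) _ ⟨?_, hmem⟩
  change ccDist _ p < ENNReal.ofReal lam * ccDist p 0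
  calc ccDist _ p ≤ ENNReal.ofReal |r - r'| := by
        conv_lhs => rw [hp]
        exact ccDist_radial_le hv
    _ ≤ ENNReal.ofReal (8 * m ^ 2) := ENNReal.ofReal_le_ofReal hdist
    _ < ENNReal.ofReal (lam * m) :=
        (ENNReal.ofReal_lt_ofReal_iff (by positivity)).2 (by nlinarith)
    _ = ENNReal.ofReal lam * ENNReal.ofReal m := ENNReal.ofReal_mul hlam0.le
    _ ≤ _ := by gcongr

end Heisenberg

/-! ### Euclidean porosity -/

namespace Heisenberg

theorem abs_horizontalNorm_sub_le_dist (p q : Heisenberg) :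
    |horizontalNorm p - horizontalNorm q| ≤ dist p q := by
  have hnorm : ∀ p : Heisenberg,
      horizontalNorm p = ‖(!₂[p 0, p 1] : EuclideanSpace ℝ (Fin 2))‖ := fun p => by
    simp [horizontalNorm, EuclideanSpace.norm_eq]
  rw [hnorm p, hnorm q]
  refine (abs_norm_sub_norm_le _ _).trans ?_
  rw [EuclideanSpace.norm_eq, EuclideanSpace.dist_eq]
  refine Real.sqrt_le_sqrt ?_
  simp only [Fin.sum_univ_two, Fin.sum_univ_three, Real.dist_eq, Real.norm_eq_abs]
  simp [sq_nonneg]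

theorem dist_radial {a b c d t : ℝ} (hv : c ^ 2 + d ^ 2 = 1) :
    dist (!₂[a * c, a * d, t] : Heisenberg) !₂[b * c, b * d, t] = |a - b| := by
  rw [EuclideanSpace.dist_eq, ← Real.sqrt_sq_eq_abs]
  congr 1
  simp [Fin.sum_univ_three, Real.dist_eq]
  linear_combination (a - b) ^ 2 * hv

/-- A criterion for porosity with respect to the Euclidean distance. -/
theorem isPorousAtWith_edist {M : Type*} [MetricSpace M] {lam : ℝ} (hlam : 0 ≤ lam) {E : Set M}
    {a : M} (x : ℕ → M) (hne : ∀ n, x n ≠ a) (hx : Tendsto x atTop (𝓝 a))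
    (hE : ∀ n, ∀ y ∈ E, lam * dist (x n) a ≤ dist y (x n)) :
    IsPorousAtWith (fun p q : M => edist p q) lam E a := by
  refine ⟨x, hne, tendsto_iff_edist_tendsto_0.1 hx, fun n => ?_⟩
  refine eq_empty_iff_forall_notMem.2 fun y ⟨hy, hyE⟩ => ?_
  have hy : edist y (x n) < ENNReal.ofReal lam * edist (x n) a := hy
  refine hy.not_ge ?_
  rw [edist_dist, edist_dist, ← ENNReal.ofReal_mul hlam]
  exact ENNReal.ofReal_le_ofReal (hE n y hyE)

theorem isPorousAtWith_edist_zero :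
    IsPorousAtWith (fun p q : Heisenberg => edist p q) (1 / 6) setPe 0 := by
  have hdist : ∀ m : ℕ, dist (!₂[0, 0, 1 / ((m : ℝ) + 1)] : Heisenberg) 0 = 1 / ((m : ℝ) + 1) := by
    intro m
    rw [EuclideanSpace.dist_eq]
    simp [Fin.sum_univ_three]
    exact Real.sqrt_sq (by positivity)
  refine isPorousAtWith_edist (by norm_num) (fun m => !₂[0, 0, 1 / ((m : ℝ) + 1)]) (fun m h => ?_)
    ?_ fun m y hy => ?_
  · have := hdist m
    rw [h, dist_self] at this
    have : 0 < 1 / ((m : ℝ) + 1) := by positivity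
    linarith
  · rw [tendsto_iff_dist_tendsto_zero]
    simp_rw [hdist]
    exact tendsto_one_div_add_atTop_nhds_zero_nat
  · rw [hdist]
    set τ := 1 / ((m : ℝ) + 1)
    have hτ : 0 < τ := by positivity
    have h1 : |y 2 - τ| ≤ dist y !₂[0, 0, τ] := by
      rw [dist_eq_norm]
      exact PiLp.norm_apply_le (y - !₂[0, 0, τ]) 2
    have h2 := abs_horizontalNorm_sub_le_dist y !₂[0, 0, τ]
    have h3 : horizontalNorm !₂[0, 0, τ] = 0 := by simp [horizontalNorm]
    have h4 : |y 2| ≤ horizontalNorm y := hy.1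
    rw [h3] at h2
    -- At distance `δ` from the axis point, `τ - δ ≤ |y 2| ≤ horizontalNorm y ≤ δ`, so `δ ≥ τ / 2`.
    linarith [abs_le.1 h1, abs_le.1 h2, le_abs_self (y 2), (abs_le.1 h1).1, (abs_le.1 h2).2]

theorem isPorousAtWith_edist_of_mem_scaledCantor {a : Heisenberg} {n k : ℕ} (hk : k < 2 ^ n)
    (ha : horizontalNorm a ∈ scaledCantor n k) :
    IsPorousAtWith (fun p q : Heisenberg => edist p q) (1 / 6) setPe a := by
  obtain ⟨s, hs, hsr⟩ := ha
  obtain ⟨c, d, hv, hpolar⟩ := exists_polar a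
  choose g hg hgap using fun m => exists_gap_cantorSet m hs
  have hQ : (0 : ℝ) < (1 / 2) ^ (2 * n) := by positivity
  have hbase : (0 : ℝ) < (1 / 2) ^ n + k * (1 / 2) ^ (2 * n) := by positivity
  have hblock := @eq_of_mem_scaledCantor n k
  simp only at hsr
  simp only [scaledCantor] at hblock
  set Q : ℝ := (1 / 2) ^ (2 * n) with hQdef
  set B : ℝ := (1 / 2) ^ n + k * Q with hB
  have hmid : ∀ m, g m ∈ Ioo (0 : ℝ) 1 \ cantorSet := fun m =>
    hgap m ⟨sub_lt_self _ (by positivity), lt_add_of_pos_right _ (by positivity)⟩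
  have hdist : ∀ m, dist (!₂[(B + Q * g m) * c, (B + Q * g m) * d, a 2] : Heisenberg) a =
      Q * |g m - s| := by
    intro m
    conv_lhs => rw [hpolar]
    rw [PiLp.toLp_apply]
    refine (dist_radial hv).trans ?_
    rw [← hsr, ← abs_of_pos hQ, ← abs_mul, abs_of_pos hQ]
    congr 1
    ring
  refine isPorousAtWith_edist (by norm_num)
    (fun m => !₂[(B + Q * g m) * c, (B + Q * g m) * d, a 2]) (fun m h => ?_) ?_ fun m y hy => ?_
  · have := hdist m
    rw [h, dist_self, eq_comm, mul_eq_zero, abs_eq_zero, sub_eq_zero] at this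
    exact (hmid m).2 (this.resolve_left hQ.ne' ▸ hs)
  · rw [tendsto_iff_dist_tendsto_zero]
    simp_rw [hdist]
    refine squeeze_zero (fun m => by positivity) (fun m => mul_le_mul_of_nonneg_left (hg m) hQ.le) ?_
    simpa using (tendsto_pow_atTop_nhds_zero_of_lt_one (by norm_num : (0 : ℝ) ≤ 1 / 3)
      (by norm_num)).const_mul Q
  · rw [hdist]
    by_contra! hlt
    have hρ : 0 ≤ B + Q * g m := by nlinarith [(hmid m).1.1]
    have hclose := (abs_horizontalNorm_sub_le_dist y _).trans_lt hlt
    rw [horizontalNorm_polar hρ hv] at hclose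
    obtain ⟨w, hw⟩ : ∃ w, horizontalNorm y = B + Q * w :=
      ⟨(horizontalNorm y - B) / Q, by field_simp; ring⟩
    -- Dividing by `Q` returns to the unit scale, where `|g m - s| ≤ (1 / 3) ^ m` turns the ratio `1
    -- / 6` into the gap radius.
    have hwg : |w - g m| < (1 / 3) ^ m / 6 := by
      rw [hw, show B + Q * w - (B + Q * g m) = Q * (w - g m) by ring, abs_mul, abs_of_pos hQ] at hclose
      have := hg m
      nlinarith
    obtain ⟨hw01, hwC⟩ := hgap m (show w ∈ _ from
      ⟨by linarith [(abs_lt.1 hwg).1], by linarith [(abs_lt.1 hwg).2]⟩)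
    rcases hy.2 with rfl | hy
    · have : horizontalNorm 0 = 0 := by simp [horizontalNorm]
      nlinarith [hw01.1]
    · simp only [mem_iUnion] at hy
      obtain ⟨n', -, k', hk', hy⟩ := hy
      have hy : horizontalNorm y ∈ scaledCantor n' k' := hy
      rw [hw] at hy
      -- As `w` is interior to `(0, 1)`, no other block can fill the gap.
      obtain ⟨rfl, rfl⟩ := hblock hk hk' hw01 hy
      obtain ⟨s', hs', hs'w⟩ := hy
      simp only [← hQdef, ← hB] at hs'w
      have : s' = w := mul_left_cancel₀ hQ.ne' (add_left_cancel hs'w)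
      exact hwC (this ▸ hs')

theorem isPorousSet_edist_setPe : IsPorousSet (fun p q : Heisenberg => edist p q) setPe := by
  refine ⟨1 / 6, by norm_num, fun a ha => ?_⟩
  rcases ha.2 with rfl | h
  · exact isPorousAtWith_edist_zero
  · simp only [mem_iUnion] at h
    obtain ⟨n, -, k, hk, h⟩ := h
    exact isPorousAtWith_edist_of_mem_scaledCantor hk h

end Heisenberg

/-- The set `P_e` is porous for the Euclidean distance; it contains `0`, and it is not porous at `0`
for the Carnot-Carathéodory distance. -/
theorem mainTheorem4 :
    IsPorousSet (fun p q : Heisenberg => edist p q) Heisenberg.setPe ∧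
      (0 : Heisenberg) ∈ Heisenberg.setPe ∧
      ¬ IsPorousAt Heisenberg.ccDist Heisenberg.setPe 0 :=
  ⟨Heisenberg.isPorousSet_edist_setPe, Heisenberg.zero_mem_setPe,
    Heisenberg.not_isPorousAt_ccDist⟩
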